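/- For every real $\theta>0$ there is a constant $\gamma=\gamma(\theta)>0$, depending only on $\theta$, such that the following holds. Let $n$ be a non-negative integer and let $u_{\{j,k\}}$, indexed by the unordered pairs $\{j,k\}$ with $1\le j\ne k\le n$, be jointly Gaussian (possibly degenerate) real random variables on a common probability space such that $$\mathbf{E}\,u_{\{j,k\}}=0\quad\text{and}\quad \mathbf{E}\,u_{\{j,k\}}^2\le\frac{\theta}{n}\quad\text{for all }\{j,k\},$$ and $$\left|\mathbf{E}\,u_{\{j_1,k_1\}}u_{\{j_2,k_2\}}\right|\le\frac{\theta}{n^2}\quad\text{whenever }\{j_1,k_1\}\cap\{j_2,k_2\}=\emptyset.$$ Let $U=\sum_{\{j,k\}}u_{\{j,k\}}^3$, the sum being over all unordered pairs. Then $U^2$ is integrable and $$\mathbf{E}\,U^2\le\gamma(\theta),$$ and for every $0<\epsilon<1/2$ with $n\ge(1/\epsilon)^{\gamma(\theta)}$ one has $$\left|\mathbf{E}\,e^{iU}-\exp\left\{-\tfrac12\,\mathbf{E}\,U^2\right\}\right|\le\epsilon,\qquad i=\sqrt{-1}.$$ -/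

import Mathlib

/-- Unordered pairs `{j, k}` with `j ≠ k` of elements of an `n`-element set. -/
abbrev UnorderedPair (n : ℕ) : Type := {e : Finset (Fin n) // e.card = 2}

/-- The random variable `U`, the sum of `u_{j,k} ^ 3` over all unordered pairs `{j, k}`. -/
noncomputable def cubicSum {n : ℕ} {Ω : Type*} (u : UnorderedPair n → Ω → ℝ) (ω : Ω) : ℝ :=
  ∑ e : UnorderedPair n, u e ω ^ 3

open MeasureTheory ProbabilityTheory Filter
open scoped NNReal ENNReal

/-! ### Gaussian integration by parts. -/

section Stein

variable {E : Type*} [NormedAddCommGroup E] [NormedSpace ℝ E]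

/-! This is Stein's method for the cubic form `U = ∑ x e ^ 3` under the law `ν` of the Gaussian
vector, with second moments `c`. Integrating by parts gives `E[U ψ(U)] = E[W ψ'(U)]` for the
explicit quartic `W = steinForm ν` (`integral_sum_pow_three_smul`). Taking `ψ = id` shows that `E U²
= E W = V`. Taking `ψ(y) = i exp(ity)` shows that the characteristic function satisfies `φ'(t) = -t
E[W exp(itU)]`. If `W` were constant this would be the Gaussian equation. In general, integrating
the derivative of `exp(Vt²/2) φ(t)` over `[0, 1]` bounds the error by `E|W - V|`
(`norm_integral_exp_sum_pow_three_sub_le`). The fluctuation of `W` is bounded by further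
integrations by parts. If variances are at most `s`, absolute row sums of `c` at most `K`, and there
are `N` coordinates, then `E W = O(N K s²)` and `Var W = O(N K³ s³)`
(`integral_steinForm_sub_sq_le`). For pairs, `N ≤ n²`, `s = θ/n` and `K = 3θ`, because only `O(n)`
pairs meet a given one (`sum_abs_le_of_disjoint`). Hence `E U²` is bounded and `Var W = O(1/n)`,
which the hypothesis on `n` makes at most `ε²`. -/

lemma hasDerivAt_gaussianPDFReal (v : ℝ≥0) (x : ℝ) :
    HasDerivAt (gaussianPDFReal 0 v) (-(x / v) * gaussianPDFReal 0 v x) x := by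
  have h1 : HasDerivAt (fun y : ℝ => -(y - 0) ^ 2 / (2 * (v : ℝ))) (-(x / v)) x := by
    have := ((((hasDerivAt_id x).sub_const (0 : ℝ)).pow 2).neg).div_const (2 * (v : ℝ))
    refine this.congr_deriv ?_
    simp only [id, sub_zero]
    by_cases hv : (v : ℝ) = 0
    · simp [hv]
    · field_simp
      norm_num
  have h2 := (h1.exp).const_mul (√(2 * Real.pi * v))⁻¹
  rw [gaussianPDFReal_def]
  refine h2.congr_deriv ?_
  ring

/-- Stein's identity for a centred real Gaussian measure. -/
theorem integral_smul_gaussianReal {v : ℝ≥0} (hv : v ≠ 0) {g g' : ℝ → E}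
    (hg : ∀ x, HasDerivAt g (g' x) x) (h0 : Integrable g (gaussianReal 0 v))
    (h1 : Integrable (fun x => x • g x) (gaussianReal 0 v))
    (h2 : Integrable g' (gaussianReal 0 v)) :
    ∫ x, x • g x ∂gaussianReal 0 v = (v : ℝ) • ∫ x, g' x ∂gaussianReal 0 v := by
  have hv' : (v : ℝ) ≠ 0 := by exact_mod_cast hv
  have key : ∀ f : ℝ → E, Integrable f (gaussianReal 0 v) →
      Integrable (fun x => gaussianPDFReal 0 v x • f x) := by
    intro f hf
    rw [gaussianReal_of_var_ne_zero _ hv, integrable_withDensity_iff_integrable_smul'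
      (measurable_gaussianPDF 0 v) (ae_of_all _ fun x => gaussianPDF_lt_top)] at hf
    simpa only [toReal_gaussianPDF] using hf
  have ibp := integral_bilinear_hasDerivAt_right_eq_neg_left_of_integrable
    (L := ContinuousLinearMap.lsmul ℝ ℝ) (u := gaussianPDFReal 0 v)
    (u' := fun x => -(x / v) * gaussianPDFReal 0 v x) (v := g) (v' := g')
    (fun x _ => hasDerivAt_gaussianPDFReal v x) (fun x _ => hg x)
    (by simpa using key _ h2)
    (by
      refine ((key _ h1).smul (-(v : ℝ)⁻¹)).congr (ae_of_all _ fun x => ?_)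
      simp only [Pi.smul_apply, ContinuousLinearMap.lsmul_apply, smul_smul]
      congr 1
      field_simp)
    (by simpa using key _ h0)
  rw [integral_gaussianReal_eq_integral_smul hv, integral_gaussianReal_eq_integral_smul hv]
  simp only [ContinuousLinearMap.lsmul_apply] at ibp
  rw [ibp, smul_neg, ← integral_smul, ← integral_neg]
  refine integral_congr_ae (ae_of_all _ fun x => ?_)
  simp only [smul_smul, ← neg_smul]
  congr 1
  field_simp

/-- Stein's identity for a centred Gaussian vector: `E[x i • G] = E[∂G]`, where `∂` is the
derivative along the `i`-th row of the covariance matrix. -/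
theorem integral_eval_smul_of_isGaussian {ι : Type*} [Fintype ι] {ν : Measure (ι → ℝ)}
    [IsGaussian ν] (h0 : ∀ i, ∫ x, x i ∂ν = 0) (i : ι) {G G' : (ι → ℝ) → E}
    (hG : ∀ x, HasLineDerivAt ℝ G (G' x) x (fun j => ∫ y, y i * y j ∂ν))
    (hGc : Continuous G) (hGc' : Continuous G') (hi0 : Integrable G ν)
    (hi1 : Integrable (fun x => x i • G x) ν) (hi2 : Integrable G' ν) :
    ∫ x, x i • G x ∂ν = ∫ x, G' x ∂ν := by
  have hid : HasGaussianLaw (fun x : ι → ℝ => fun j => x j) ν :=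
    IsGaussian.hasGaussianLaw_id
  have hi : HasGaussianLaw (fun x : ι → ℝ => x i) ν := hid.eval i
  have hL2 : ∀ j, MemLp (fun x : ι → ℝ => x j) 2 ν := fun j => (hid.eval j).memLp_two
  set c : ι → ℝ := fun j => ∫ y, y i * y j ∂ν with hc
  have hcov : ∀ j, cov[fun x : ι → ℝ => x i, fun x => x j; ν] = c j := by
    intro j
    rw [covariance_eq_sub (hL2 i) (hL2 j)]
    simp [h0, hc]
  have hvar : Var[fun x : ι → ℝ => x i; ν] = c i := by
    rw [← covariance_self hi.aemeasurable, hcov]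
  -- Degenerate case: `x i` vanishes almost everywhere, so the whole row `c` is zero and both sides
  -- are zero.
  by_cases hv : c i = 0
  · have hae : (fun x : ι → ℝ => x i) =ᵐ[ν] 0 := by
      have : ∫ x : ι → ℝ, x i ^ 2 ∂ν = 0 := by rw [← hv, hc]; simp [pow_two]
      rw [integral_eq_zero_iff_of_nonneg (fun x => sq_nonneg _) (hL2 i).integrable_sq] at this
      filter_upwards [this] with x hx
      simpa using hx
    have hc0 : c = 0 := by
      funext j
      refine integral_eq_zero_of_ae ?_
      filter_upwards [hae] with x hx
      simp only [Pi.zero_apply] at hx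
      simp [hx]
    have hz : ∀ x, G' x = 0 := fun x => by
      have := hG x
      rw [hc0] at this
      exact this.unique (by simpa [HasLineDerivAt] using hasDerivAt_const (0 : ℝ) (G x))
    simp only [hz, integral_zero]
    refine integral_eq_zero_of_ae ?_
    filter_upwards [hae] with x hx
    simp only [Pi.zero_apply] at hx
    simp [hx]
  -- Regression on `x i`: the residual `Z` is uncorrelated with `x i`, hence independent of it by
  -- joint Gaussianity. The one-dimensional identity then applies on each line `t ↦ z + t • a`.
  · set a : ι → ℝ := fun j => c j / c i with ha
    set Z : (ι → ℝ) → ι → ℝ := fun x => x - x i • a with hZ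
    have hind : IndepFun (fun x : ι → ℝ => x i) Z ν := by
      have h1 : IndepFun (fun (x : ι → ℝ) (_ : Unit) => x i) (fun x j => x j - x i * a j) ν := by
        refine HasGaussianLaw.indepFun_of_covariance_eval (X := fun (_ : Unit) (x : ι → ℝ) => x i)
          (Y := fun j x => x j - x i * a j) ?_ ?_
        · let L : (ι → ℝ) →L[ℝ] (Unit → ℝ) × (ι → ℝ) :=
            (ContinuousLinearMap.pi fun _ => ContinuousLinearMap.proj i).prod
              (ContinuousLinearMap.id ℝ (ι → ℝ) -
              (ContinuousLinearMap.proj i).smulRight a)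
          exact hid.map_fun L
        · intro _ j
          rw [covariance_fun_sub_right (hL2 i) (hL2 j) ((hL2 i).mul_const _),
            covariance_mul_const_right, hcov, covariance_self hi.aemeasurable, hvar, ha]
          field_simp
          simp
      exact h1.comp (φ := fun f : Unit → ℝ => f ()) (ψ := id) (by fun_prop) measurable_id
    have hcpos : 0 ≤ c i := hvar ▸ variance_nonneg _ _
    set v : ℝ≥0 := ⟨c i, hcpos⟩ with hvdef
    have hv0 : v ≠ 0 := fun h => hv (congrArg NNReal.toReal h)
    have hlaw : ν.map (fun x => x i) = gaussianReal 0 v := by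
      rw [hi.map_eq_gaussianReal, h0, hvar]
      congr 1
      ext
      rw [Real.coe_toNNReal _ hcpos]
      rfl
    have hZm : Measurable Z := by fun_prop
    have hprod : ν.map (fun x : ι → ℝ => (x i, Z x)) = (gaussianReal 0 v).prod (ν.map Z) := by
      rw [(indepFun_iff_map_prod_eq_prod_map_map hi.aemeasurable hZm.aemeasurable).1 hind, hlaw]
    have : IsProbabilityMeasure (ν.map Z) := Measure.isProbabilityMeasure_map hZm.aemeasurable
    have hrec : ∀ x, Z x + x i • a = x := fun x => by simp [hZ]
    have hmp : Measurable (fun x : ι → ℝ => (x i, Z x)) := by fun_prop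
    have htrans : ∀ F : (ι → ℝ) → E, Continuous F → Integrable F ν →
        Integrable (fun p : ℝ × (ι → ℝ) => F (p.2 + p.1 • a))
          ((gaussianReal 0 v).prod (ν.map Z)) ∧
        ∫ x, F x ∂ν = ∫ z, ∫ t, F (z + t • a) ∂gaussianReal 0 v ∂ν.map Z := by
      intro F hF hFi
      have hFc : Continuous (fun p : ℝ × (ι → ℝ) => F (p.2 + p.1 • a)) := by fun_prop
      have h1 : Integrable (fun p : ℝ × (ι → ℝ) => F (p.2 + p.1 • a))
          ((gaussianReal 0 v).prod (ν.map Z)) := by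
        rw [← hprod, integrable_map_measure hFc.aestronglyMeasurable hmp.aemeasurable]
        exact hFi.congr (ae_of_all _ fun x => by simp [hrec])
      refine ⟨h1, ?_⟩
      rw [← integral_prod_symm (fun p : ℝ × (ι → ℝ) => F (p.2 + p.1 • a)) h1, ← hprod,
        integral_map hmp.aemeasurable hFc.aestronglyMeasurable]
      simp [hrec]
    have hZi : ∀ᵐ z ∂ν.map Z, z i = 0 := by
      rw [ae_map_iff hZm.aemeasurable (measurableSet_eq_fun (by fun_prop) (by fun_prop))]
      refine ae_of_all _ fun x => ?_
      simp [hZ, ha, div_self hv]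
    have hai : a i = 1 := div_self hv
    obtain ⟨hA0, -⟩ := htrans G hGc hi0
    obtain ⟨hA1, hB1⟩ := htrans (fun x => x i • G x) (by fun_prop) hi1
    obtain ⟨hA2, hB2⟩ := htrans G' hGc' hi2
    rw [hB1, hB2]
    refine integral_congr_ae ?_
    filter_upwards [hZi, hA0.prod_left_ae, hA1.prod_left_ae, hA2.prod_left_ae]
      with z hz k0 k1 k2
    simp only [Pi.add_apply, Pi.smul_apply, hz, hai, smul_eq_mul, mul_one, zero_add] at k1 ⊢
    -- The direction `a` is the row `c` divided by `c i`; this factor cancels the variance in the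
    -- one-dimensional identity.
    have hd : ∀ t, HasDerivAt (fun t : ℝ => G (z + t • a)) ((c i)⁻¹ • G' (z + t • a)) t := by
      intro t
      have h1 := hG (z + t • a)
      unfold HasLineDerivAt at h1
      have h2 : HasDerivAt (fun r : ℝ => (r - t) * (c i)⁻¹) (c i)⁻¹ t := by
        simpa using ((hasDerivAt_id t).sub_const t).mul_const (c i)⁻¹
      have h3 := HasDerivAt.scomp_of_eq (x := t) h1 h2 (by simp)
      refine h3.congr_of_eventuallyEq (Eventually.of_forall fun r => ?_)
      simp only [Function.comp]
      congr 1
      funext j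
      simp only [Pi.add_apply, Pi.smul_apply, smul_eq_mul, ha, hc]
      change _ = z j + t * (c j / c i) + (r - t) * (c i)⁻¹ * c j
      ring
    rw [integral_smul_gaussianReal hv0 hd k0 k1 (k2.smul _), integral_smul, smul_smul]
    change (c i * (c i)⁻¹) • _ = _
    rw [mul_inv_cancel₀ hv, one_smul]

end Stein

/-! ### A class closed under products, for integrability side conditions. -/

section Moments

variable {Ω : Type*} [MeasurableSpace Ω] [TopologicalSpace Ω]
  {E : Type*} [NormedAddCommGroup E]

/-- Continuous functions all of whose moments are finite. -/
structure HasFiniteMoments (f : Ω → E) (ν : Measure Ω) : Prop where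
  continuous : Continuous f
  memLp : ∀ p : ℝ≥0∞, p ≠ ∞ → MemLp f p ν

namespace HasFiniteMoments

variable {ν : Measure Ω}

lemma integrable {f : Ω → E} (hf : HasFiniteMoments f ν) : Integrable f ν :=
  memLp_one_iff_integrable.1 (hf.memLp 1 (by simp))

lemma const [IsFiniteMeasure ν] (a : E) : HasFiniteMoments (fun _ : Ω => a) ν :=
  ⟨continuous_const, fun _ _ => memLp_const a⟩

lemma add {f g : Ω → E} (hf : HasFiniteMoments f ν) (hg : HasFiniteMoments g ν) :
    HasFiniteMoments (fun x => f x + g x) ν :=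
  ⟨hf.continuous.add hg.continuous, fun p hp => (hf.memLp p hp).add (hg.memLp p hp)⟩

lemma sub {f g : Ω → E} (hf : HasFiniteMoments f ν) (hg : HasFiniteMoments g ν) :
    HasFiniteMoments (fun x => f x - g x) ν :=
  ⟨hf.continuous.sub hg.continuous, fun p hp => (hf.memLp p hp).sub (hg.memLp p hp)⟩

/-- Hölder with both exponents equal to `2p`. -/
lemma smul [NormedSpace ℝ E] {f : Ω → ℝ} {g : Ω → E} (hf : HasFiniteMoments f ν) (hg : HasFiniteMoments g ν) :
    HasFiniteMoments (fun x => f x • g x) ν := by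
  refine ⟨hf.continuous.smul hg.continuous, fun p hp => ?_⟩
  have : ENNReal.HolderTriple (2 * p) (2 * p) p := ⟨by
    rw [ENNReal.mul_inv (by simp) (by simp), ← add_mul, ENNReal.inv_two_add_inv_two, one_mul]⟩
  have h2 : 2 * p ≠ ∞ := ENNReal.mul_ne_top (by simp) hp
  exact (hg.memLp _ h2).smul (hf.memLp _ h2)

lemma mul {f g : Ω → ℝ} (hf : HasFiniteMoments f ν) (hg : HasFiniteMoments g ν) :
    HasFiniteMoments (fun x => f x * g x) ν := hf.smul hg

lemma pow [IsFiniteMeasure ν] {f : Ω → ℝ} (hf : HasFiniteMoments f ν) (n : ℕ) :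
    HasFiniteMoments (fun x => f x ^ n) ν := by
  induction n with
  | zero => simpa using const (1 : ℝ)
  | succ n ih => simpa [pow_succ] using ih.mul hf

lemma abs {f : Ω → ℝ} (hf : HasFiniteMoments f ν) : HasFiniteMoments (fun x => |f x|) ν :=
  ⟨hf.continuous.abs, fun p hp => (hf.memLp p hp).abs⟩

lemma sum {κ : Type*} (s : Finset κ) {f : κ → Ω → E} (hf : ∀ k, HasFiniteMoments (f k) ν) :
    HasFiniteMoments (fun x => ∑ k ∈ s, f k x) ν :=
  ⟨continuous_finsetSum _ fun k _ => (hf k).continuous,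
    fun p hp => memLp_finsetSum _ fun k _ => (hf k).memLp p hp⟩

lemma of_bound [OpensMeasurableSpace Ω] [SecondCountableTopologyEither Ω E] [IsFiniteMeasure ν]
    {f : Ω → E} (hf : Continuous f) (C : ℝ) (h : ∀ x, ‖f x‖ ≤ C) : HasFiniteMoments f ν :=
  ⟨hf, fun _ _ => MemLp.of_bound hf.aestronglyMeasurable C (ae_of_all _ h)⟩

end HasFiniteMoments

end Moments

/-! ### Calculus rules for directional derivatives. -/

section LineDeriv

variable {V E : Type*} [AddCommGroup V] [Module ℝ V] [NormedAddCommGroup E] [NormedSpace ℝ E]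

lemma HasLineDerivAt.fun_smul {f : V → ℝ} {F : V → E} {f' : ℝ} {F' : E} {x v : V}
    (hf : HasLineDerivAt ℝ f f' x v) (hF : HasLineDerivAt ℝ F F' x v) :
    HasLineDerivAt ℝ (fun y => f y • F y) (f x • F' + f' • F x) x v := by
  unfold HasLineDerivAt at *
  simpa using hf.fun_smul hF

lemma HasLineDerivAt.fun_mul {f g : V → ℝ} {f' g' : ℝ} {x v : V}
    (hf : HasLineDerivAt ℝ f f' x v) (hg : HasLineDerivAt ℝ g g' x v) :
    HasLineDerivAt ℝ (fun y => f y * g y) (f x * g' + f' * g x) x v := hf.fun_smul hg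

lemma HasLineDerivAt.fun_sum {κ : Type*} {s : Finset κ} {F : κ → V → E} {F' : κ → E} {x v : V}
    (h : ∀ k, HasLineDerivAt ℝ (F k) (F' k) x v) :
    HasLineDerivAt ℝ (fun y => ∑ k ∈ s, F k y) (∑ k ∈ s, F' k) x v := by
  unfold HasLineDerivAt at *
  exact HasDerivAt.fun_sum fun k _ => h k

lemma HasLineDerivAt.fun_pow {f : V → ℝ} {f' : ℝ} {x v : V}
    (hf : HasLineDerivAt ℝ f f' x v) (n : ℕ) :
    HasLineDerivAt ℝ (fun y => f y ^ n) (n * f x ^ (n - 1) * f') x v := by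
  unfold HasLineDerivAt at *
  simpa using hf.fun_pow n

lemma hasLineDerivAt_eval {ι : Type*} (i : ι) (x v : ι → ℝ) :
    HasLineDerivAt ℝ (fun y : ι → ℝ => y i) (v i) x v := by
  unfold HasLineDerivAt
  simpa using ((hasDerivAt_id (0 : ℝ)).mul_const (v i)).const_add (x i)

end LineDeriv

/-! ### Moments of Gaussian vectors. -/

section GaussianVector

variable {ι : Type*} {E : Type*} [NormedAddCommGroup E] [NormedSpace ℝ E]

/-- The matrix of second moments of a measure on `ι → ℝ`. -/
noncomputable def secondMoment (ν : Measure (ι → ℝ)) (i j : ι) : ℝ := ∫ x, x i * x j ∂ν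

lemma secondMoment_comm (ν : Measure (ι → ℝ)) (i j : ι) :
    secondMoment ν i j = secondMoment ν j i := by
  simp only [secondMoment, mul_comm]

lemma secondMoment_self_nonneg (ν : Measure (ι → ℝ)) (i : ι) : 0 ≤ secondMoment ν i i :=
  integral_nonneg fun x => mul_self_nonneg (x i)

variable {ν : Measure (ι → ℝ)}

lemma integral_eval_sq (i : ι) : ∫ x, x i ^ 2 ∂ν = secondMoment ν i i := by
  simp only [secondMoment, pow_two]

variable [IsGaussian ν]

lemma hasFiniteMoments_eval (i : ι) : HasFiniteMoments (fun x : ι → ℝ => x i) ν :=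
  ⟨continuous_apply i, fun _ hp =>
    (HasGaussianLaw.eval (X := fun (i : ι) (x : ι → ℝ) => x i)
      (IsGaussian.hasGaussianLaw_id (μ := ν)) i).memLp hp⟩

lemma abs_secondMoment_le {s : ℝ} (hs : ∀ i, secondMoment ν i i ≤ s) (i j : ι) :
    |secondMoment ν i j| ≤ s := by
  have hx := hasFiniteMoments_eval (ν := ν)
  calc |secondMoment ν i j| ≤ ∫ x, |x i * x j| ∂ν := abs_integral_le_integral_abs
    _ ≤ ∫ x, (1 / 2) * (x i ^ 2 + x j ^ 2) ∂ν := by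
      refine integral_mono ((hx i).mul (hx j)).abs.integrable ((((hx i).pow 2).integrable.add
        ((hx j).pow 2).integrable).const_mul _) fun x => ?_
      dsimp only
      rw [abs_mul, ← sq_abs (x i), ← sq_abs (x j)]
      nlinarith [sq_nonneg (|x i| - |x j|)]
    _ ≤ s := by
      rw [integral_const_mul, integral_add ((hx i).pow 2).integrable
        ((hx j).pow 2).integrable, integral_eval_sq, integral_eval_sq]
      linarith [hs i, hs j]

variable [Fintype ι]

lemma integral_eval_smul (h0 : ∀ i, ∫ x, x i ∂ν = 0) (i : ι) {G G' : (ι → ℝ) → E}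
    (hG : ∀ x, HasLineDerivAt ℝ G (G' x) x (secondMoment ν i))
    (hGm : HasFiniteMoments G ν) (hGm' : HasFiniteMoments G' ν) :
    ∫ x, x i • G x ∂ν = ∫ x, G' x ∂ν :=
  integral_eval_smul_of_isGaussian h0 i hG hGm.continuous hGm'.continuous hGm.integrable
    ((hasFiniteMoments_eval i).smul hGm).integrable hGm'.integrable

/-- Integrating by parts with `x i ^ 2 • F` leaves a multiple of `x i • F`; a second integration
makes every term carry `F'`. -/
lemma integral_eval_pow_three_smul (h0 : ∀ i, ∫ x, x i ∂ν = 0) (i : ι) {F F' : (ι → ℝ) → E}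
    (hF : ∀ x, HasLineDerivAt ℝ F (F' x) x (secondMoment ν i))
    (hFm : HasFiniteMoments F ν) (hFm' : HasFiniteMoments F' ν) :
    ∫ x, x i ^ 3 • F x ∂ν = ∫ x, (2 * secondMoment ν i i + x i ^ 2) • F' x ∂ν := by
  have hx := hasFiniteMoments_eval (ν := ν) i
  have h1 := integral_eval_smul h0 i hF hFm hFm'
  have h2 := integral_eval_smul h0 i (G := fun x => x i ^ 2 • F x)
    (fun x => ((hasLineDerivAt_eval i x _).fun_pow 2).fun_smul (hF x))
    ((hx.pow 2).smul hFm)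
    (((hx.pow 2).smul hFm').add (((((HasFiniteMoments.const _).mul (hx.pow _))).mul
      (.const _)).smul hFm))
  calc ∫ x, x i ^ 3 • F x ∂ν = ∫ x, x i • x i ^ 2 • F x ∂ν := by
        simp only [smul_smul]; congr! 3; ring
    _ = ∫ x, x i ^ 2 • F' x ∂ν + (2 * secondMoment ν i i) • ∫ x, x i • F x ∂ν := by
        rw [h2, integral_add ((hx.pow 2).smul hFm').integrable, ← integral_smul]
        · simp only [smul_smul]; congr! 4; push_cast; ring
        · exact (((((HasFiniteMoments.const _).mul (hx.pow _))).mul (.const _)).smul hFm).integrable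
    _ = _ := by
        rw [h1, ← integral_smul, ← integral_add ((hx.pow 2).smul hFm').integrable
          (((HasFiniteMoments.const _).smul hFm').integrable)]
        simp only [add_smul]; congr! 2; rw [add_comm]

lemma integral_eval_pow_add_two (h0 : ∀ i, ∫ x, x i ∂ν = 0) (i : ι) (n : ℕ) :
    ∫ x, x i ^ (n + 2) ∂ν = (n + 1) * secondMoment ν i i * ∫ x, x i ^ n ∂ν := by
  have hx := hasFiniteMoments_eval (ν := ν) i
  have h := integral_eval_smul h0 i (G := fun x => x i ^ (n + 1))
    (fun x => (hasLineDerivAt_eval i x _).fun_pow (n + 1)) (hx.pow _)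
    (((HasFiniteMoments.const _).mul (hx.pow _)).mul (.const _))
  rw [← integral_const_mul]
  simp only [smul_eq_mul] at h
  convert h using 1
  · congr! 2; ring
  · congr! 2; push_cast; ring_nf

lemma integral_eval_pow_four_le (h0 : ∀ i, ∫ x, x i ∂ν = 0) {s : ℝ}
    (hs : ∀ i, secondMoment ν i i ≤ s) (i : ι) : ∫ x, x i ^ 4 ∂ν ≤ 3 * s ^ 2 := by
  have h := integral_eval_pow_add_two h0 i 2
  have hc := secondMoment_self_nonneg ν i
  rw [integral_eval_sq] at h
  norm_num at h
  nlinarith [hs i]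

lemma integral_eval_pow_six_le (h0 : ∀ i, ∫ x, x i ∂ν = 0) {s : ℝ}
    (hs : ∀ i, secondMoment ν i i ≤ s) (i : ι) : ∫ x, x i ^ 6 ∂ν ≤ 15 * s ^ 3 := by
  have h := integral_eval_pow_add_two h0 i 4
  have h4 := integral_eval_pow_four_le h0 hs i
  have hc := secondMoment_self_nonneg ν i
  norm_num at h
  have := mul_le_mul (hs i) h4 (integral_nonneg fun x => by positivity) (hc.trans (hs i))
  rw [h]
  nlinarith

/-- AM-GM reduces to pure moments. The cubic factor is a typical summand of `steinFormDeriv`; this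
and the next bound feed the variance estimate. -/
lemma integral_abs_mul_quadratic_le (h0 : ∀ i, ∫ x, x i ∂ν = 0) {s : ℝ}
    (hs : ∀ i, secondMoment ν i i ≤ s) (a e f : ι) :
    ∫ x, |x a * (x e * (x f ^ 2 + secondMoment ν f f))| ∂ν ≤ 4 * s ^ 2 := by
  have hx := hasFiniteMoments_eval (ν := ν)
  have hc := secondMoment_self_nonneg ν f
  have hcs := hs f
  set c := secondMoment ν f f
  have hi4 := fun i => ((hx i).pow 4).integrable
  have hi2 := fun i => ((hx i).pow 2).integrable
  calc ∫ x, |x a * (x e * (x f ^ 2 + c))| ∂ν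
      ≤ ∫ x, ((1 / 4) * (x a ^ 4 + x e ^ 4 + 2 * x f ^ 4) + c / 2 * (x a ^ 2 + x e ^ 2)) ∂ν := by
        refine integral_mono (((hx a).mul ((hx e).mul (((hx f).pow 2).add (.const c)))).abs).integrable
          (by fun_prop (disch := assumption)) fun x => ?_
        simp only [abs_mul]
        rw [abs_of_nonneg (show 0 ≤ x f ^ 2 + c by positivity)]
        have h1 : |x a| * |x e| ≤ (x a ^ 2 + x e ^ 2) / 2 := by
          rw [← sq_abs (x a), ← sq_abs (x e)]
          nlinarith [sq_nonneg (|x a| - |x e|)]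
        nlinarith [mul_le_mul_of_nonneg_right h1 (show 0 ≤ x f ^ 2 + c by positivity),
          sq_nonneg (x a ^ 2 - x f ^ 2), sq_nonneg (x e ^ 2 - x f ^ 2)]
    _ = (1 / 4) * (∫ x, x a ^ 4 ∂ν + ∫ x, x e ^ 4 ∂ν + 2 * ∫ x, x f ^ 4 ∂ν)
        + c / 2 * (∫ x, x a ^ 2 ∂ν + ∫ x, x e ^ 2 ∂ν) := by
        rw [integral_add (by fun_prop (disch := assumption)) (by fun_prop (disch := assumption)),
          integral_const_mul, integral_const_mul, integral_add (by fun_prop) (hi2 e),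
          integral_add (by fun_prop) (by fun_prop), integral_add (hi4 a) (hi4 e),
          integral_const_mul]
    _ ≤ 4 * s ^ 2 := by
        simp only [integral_eval_sq]
        have := integral_eval_pow_four_le h0 hs
        nlinarith [this a, this e, this f, hs a, hs e, secondMoment_self_nonneg ν a,
          secondMoment_self_nonneg ν e, mul_le_mul hcs (add_le_add (hs a) (hs e))
          (add_nonneg (secondMoment_self_nonneg ν a) (secondMoment_self_nonneg ν e))
          (hc.trans hcs)]

lemma integral_abs_mul_sq_mul_quadratic_le (h0 : ∀ i, ∫ x, x i ∂ν = 0) {s : ℝ}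
    (hs : ∀ i, secondMoment ν i i ≤ s) (a b e f : ι) :
    ∫ x, |(x a * x b ^ 2) * (x e * (x f ^ 2 + secondMoment ν f f))| ∂ν ≤ 18 * s ^ 3 := by
  have hx := hasFiniteMoments_eval (ν := ν)
  have hc := secondMoment_self_nonneg ν f
  have hcs := hs f
  set c := secondMoment ν f f
  have hi6 := fun i => ((hx i).pow 6).integrable
  have hi4 := fun i => ((hx i).pow 4).integrable
  have J4 : Integrable (fun x : ι → ℝ => x a ^ 4 + x e ^ 4) ν := (hi4 a).add (hi4 e)
  have I4 : Integrable (fun x : ι → ℝ => x a ^ 4 + x e ^ 4 + 2 * x b ^ 4) ν :=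
    J4.add ((hi4 b).const_mul 2)
  have J6 : Integrable (fun x : ι → ℝ => x a ^ 6 + x e ^ 6) ν := (hi6 a).add (hi6 e)
  have J6' : Integrable (fun x : ι → ℝ => x a ^ 6 + x e ^ 6 + 2 * x b ^ 6) ν :=
    J6.add ((hi6 b).const_mul 2)
  have I6 : Integrable (fun x : ι → ℝ => x a ^ 6 + x e ^ 6 + 2 * x b ^ 6 + 2 * x f ^ 6) ν :=
    J6'.add ((hi6 f).const_mul 2)
  calc ∫ x, |(x a * x b ^ 2) * (x e * (x f ^ 2 + c))| ∂ν
      ≤ ∫ x, ((1 / 6) * (x a ^ 6 + x e ^ 6 + 2 * x b ^ 6 + 2 * x f ^ 6)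
          + c / 4 * (x a ^ 4 + x e ^ 4 + 2 * x b ^ 4)) ∂ν := by
        refine integral_mono ((((hx a).mul ((hx b).pow 2)).mul
          ((hx e).mul (((hx f).pow 2).add (.const c)))).abs).integrable
          ((I6.const_mul (1 / 6)).add (I4.const_mul (c / 4))) fun x => ?_
        have h1 : |x a| * |x e| ≤ (x a ^ 2 + x e ^ 2) / 2 := by
          rw [← sq_abs (x a), ← sq_abs (x e)]
          nlinarith [sq_nonneg (|x a| - |x e|)]
        have amgm : ∀ p q r : ℝ, 0 ≤ p → 0 ≤ q → 0 ≤ r →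
            p * q * r ≤ (p ^ 3 + q ^ 3 + r ^ 3) / 3 := fun p q r hp hq hr => by
          nlinarith [mul_nonneg (add_nonneg (add_nonneg hp hq) hr) (add_nonneg (add_nonneg
            (sq_nonneg (p - q)) (sq_nonneg (q - r))) (sq_nonneg (p - r)))]
        have h2 := amgm (x a ^ 2) (x b ^ 2) (x f ^ 2) (sq_nonneg _) (sq_nonneg _) (sq_nonneg _)
        have h3 := amgm (x e ^ 2) (x b ^ 2) (x f ^ 2) (sq_nonneg _) (sq_nonneg _) (sq_nonneg _)
        have h4 : x a ^ 2 * x b ^ 2 ≤ (x a ^ 4 + x b ^ 4) / 2 := by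
          nlinarith [sq_nonneg (x a ^ 2 - x b ^ 2)]
        have h5 : x e ^ 2 * x b ^ 2 ≤ (x e ^ 4 + x b ^ 4) / 2 := by
          nlinarith [sq_nonneg (x e ^ 2 - x b ^ 2)]
        calc |(x a * x b ^ 2) * (x e * (x f ^ 2 + c))|
            = (|x a| * |x e|) * (x b ^ 2 * (x f ^ 2 + c)) := by
              simp only [abs_mul]
              rw [abs_of_nonneg (show 0 ≤ x f ^ 2 + c by positivity),
                abs_of_nonneg (sq_nonneg (x b))]
              ring
          _ ≤ (x a ^ 2 + x e ^ 2) / 2 * (x b ^ 2 * (x f ^ 2 + c)) :=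
              mul_le_mul_of_nonneg_right h1 (by positivity)
          _ = (x a ^ 2 * x b ^ 2 * x f ^ 2 + x e ^ 2 * x b ^ 2 * x f ^ 2) / 2
              + c / 2 * (x a ^ 2 * x b ^ 2 + x e ^ 2 * x b ^ 2) := by ring
          _ ≤ _ := by
              have := mul_le_mul_of_nonneg_left (add_le_add h4 h5) (show 0 ≤ c / 2 by positivity)
              linarith
    _ = (1 / 6) * (∫ x, x a ^ 6 ∂ν + ∫ x, x e ^ 6 ∂ν + 2 * ∫ x, x b ^ 6 ∂ν + 2 * ∫ x, x f ^ 6 ∂ν)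
        + c / 4 * (∫ x, x a ^ 4 ∂ν + ∫ x, x e ^ 4 ∂ν + 2 * ∫ x, x b ^ 4 ∂ν) := by
        rw [integral_add (I6.const_mul (1 / 6)) (I4.const_mul (c / 4)),
          integral_const_mul, integral_const_mul,
          integral_add J6' ((hi6 f).const_mul 2), integral_add J6 ((hi6 b).const_mul 2),
          integral_add (hi6 a) (hi6 e), integral_add J4 ((hi4 b).const_mul 2),
          integral_add (hi4 a) (hi4 e),
          integral_const_mul, integral_const_mul, integral_const_mul]
    _ ≤ 18 * s ^ 3 := by
        have h4 := integral_eval_pow_four_le h0 hs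
        have h6 := integral_eval_pow_six_le h0 hs
        have : c * (∫ x, x a ^ 4 ∂ν + ∫ x, x e ^ 4 ∂ν + 2 * ∫ x, x b ^ 4 ∂ν) ≤
            s * (12 * s ^ 2) := by
          refine mul_le_mul hcs (by linarith [h4 a, h4 b, h4 e]) ?_ (hc.trans hcs)
          have := fun i => integral_nonneg (μ := ν) (f := fun x : ι → ℝ => x i ^ 4)
            fun x => by positivity
          linarith [this a, this b, this e]
        nlinarith [h6 a, h6 b, h6 e, h6 f]

end GaussianVector

/-! ### Stein's identity for the cubic form, and the mean and variance of `steinForm`. -/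

section CubicForm

variable {ι : Type*} [Fintype ι] {E : Type*} [NormedAddCommGroup E] [NormedSpace ℝ E]

/-- The quartic form `W` with `E[U • ψ(U)] = E[W • ψ'(U)]`, where `U = ∑ x i ^ 3`. -/
noncomputable def steinForm (ν : Measure (ι → ℝ)) (x : ι → ℝ) : ℝ :=
  ∑ e, ∑ f, secondMoment ν e f * ((6 * secondMoment ν e e + 3 * x e ^ 2) * x f ^ 2)

/-- The derivative of `steinForm ν` along the `g`-th row of the matrix of second moments. -/
noncomputable def steinFormDeriv (ν : Measure (ι → ℝ)) (g : ι) (x : ι → ℝ) : ℝ :=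
  ∑ e, ∑ f, secondMoment ν g e * secondMoment ν e f *
    (12 * (x e * (x f ^ 2 + secondMoment ν f f)))

lemma hasLineDerivAt_steinForm (ν : Measure (ι → ℝ)) (g : ι) (x : ι → ℝ) :
    HasLineDerivAt ℝ (steinForm ν) (steinFormDeriv ν g x) x (secondMoment ν g) := by
  have h : HasLineDerivAt ℝ (steinForm ν) _ x (secondMoment ν g) :=
    HasLineDerivAt.fun_sum (s := Finset.univ) fun e => HasLineDerivAt.fun_sum (s := Finset.univ)
      fun f => ((hasDerivAt_const (0 : ℝ) (secondMoment ν e f)).fun_mul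
        (((hasDerivAt_const (0 : ℝ) (6 * secondMoment ν e e)).fun_add
        ((hasDerivAt_const (0 : ℝ) (3 : ℝ)).fun_mul
          ((hasLineDerivAt_eval e x (secondMoment ν g)).fun_pow 2))).fun_mul
        ((hasLineDerivAt_eval f x (secondMoment ν g)).fun_pow 2)))
  convert h using 1
  simp only [zero_smul, add_zero, zero_mul, zero_add]
  -- The product rule hits either `x e` or `x f`. Swapping the indices by symmetry of the second
  -- moments merges the two cases, with `12 = 6 + 6` on the cubic part.
  have hswap : steinFormDeriv ν g x = ∑ e, ∑ f,
      (secondMoment ν e f * (secondMoment ν g e * (6 * (x e * x f ^ 2))) +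
       secondMoment ν e f * (secondMoment ν g f *
        (6 * (x f * x e ^ 2) + 12 * x f * secondMoment ν e e))) := by
    simp only [Finset.sum_add_distrib]
    rw [Finset.sum_comm (f := fun e f => secondMoment ν e f * (secondMoment ν g f *
        (6 * (x f * x e ^ 2) + 12 * x f * secondMoment ν e e)))]
    simp only [← Finset.sum_add_distrib]
    refine Finset.sum_congr rfl fun e _ => Finset.sum_congr rfl fun f _ => ?_
    rw [secondMoment_comm ν f e]
    ring
  rw [hswap]
  refine Finset.sum_congr rfl fun e _ => Finset.sum_congr rfl fun f _ => ?_
  push_cast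
  ring

lemma hasLineDerivAt_sum_pow_three (x v : ι → ℝ) :
    HasLineDerivAt ℝ (fun y : ι → ℝ => ∑ f, y f ^ 3) (∑ f, 3 * x f ^ 2 * v f) x v :=
  HasLineDerivAt.fun_sum (s := Finset.univ) fun f => (hasLineDerivAt_eval f x v).fun_pow 3

variable {ν : Measure (ι → ℝ)} [IsGaussian ν]

lemma hasFiniteMoments_steinForm : HasFiniteMoments (steinForm ν) ν := by
  have hx := hasFiniteMoments_eval (ν := ν)
  exact .sum _ fun e => .sum _ fun f => (HasFiniteMoments.const _).mul
    (((HasFiniteMoments.const _).add ((HasFiniteMoments.const _).mul ((hx e).pow 2))).mul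
      ((hx f).pow 2))

lemma hasFiniteMoments_steinFormDeriv (g : ι) : HasFiniteMoments (steinFormDeriv ν g) ν := by
  have hx := hasFiniteMoments_eval (ν := ν)
  exact .sum _ fun e => .sum _ fun f => (HasFiniteMoments.const _).mul
    ((HasFiniteMoments.const _).mul ((hx e).mul (((hx f).pow 2).add (HasFiniteMoments.const _))))

lemma hasFiniteMoments_sum_pow_three :
    HasFiniteMoments (fun x : ι → ℝ => ∑ f, x f ^ 3) ν :=
  .sum _ fun f => (hasFiniteMoments_eval f).pow 3

/-- Stein's identity for functions of the cubic form `U = ∑ x i ^ 3`. -/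
lemma integral_sum_pow_three_smul (h0 : ∀ i, ∫ x, x i ∂ν = 0) {ψ ψ' : ℝ → E}
    (hψ : ∀ y, HasDerivAt ψ (ψ' y) y)
    (hm : HasFiniteMoments (fun x : ι → ℝ => ψ (∑ f, x f ^ 3)) ν)
    (hm' : HasFiniteMoments (fun x : ι → ℝ => ψ' (∑ f, x f ^ 3)) ν) :
    ∫ x, (∑ f, x f ^ 3) • ψ (∑ f, x f ^ 3) ∂ν =
      ∫ x, steinForm ν x • ψ' (∑ f, x f ^ 3) ∂ν := by
  have hx := hasFiniteMoments_eval (ν := ν)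
  have hD : ∀ e, HasFiniteMoments
      (fun x : ι → ℝ => (∑ f, 3 * x f ^ 2 * secondMoment ν e f) • ψ' (∑ f, x f ^ 3)) ν := fun e =>
    (HasFiniteMoments.sum _ fun f => ((HasFiniteMoments.const _).mul ((hx f).pow 2)).mul
      (.const _)).smul hm'
  have h1 : ∀ e, ∫ x, x e ^ 3 • ψ (∑ f, x f ^ 3) ∂ν =
      ∫ x, (2 * secondMoment ν e e + x e ^ 2) •
        ((∑ f, 3 * x f ^ 2 * secondMoment ν e f) • ψ' (∑ f, x f ^ 3)) ∂ν := fun e => by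
    refine integral_eval_pow_three_smul h0 e (fun x => ?_) hm (hD e)
    exact HasDerivAt.scomp_of_eq (0 : ℝ) (hψ _)
      (hasLineDerivAt_sum_pow_three x (secondMoment ν e)) (by simp)
  simp only [Finset.sum_smul]
  rw [integral_finsetSum _ fun e _ => (((hx e).pow 3).smul hm).integrable]
  simp only [h1]
  rw [← integral_finsetSum _ fun e _ => ((((HasFiniteMoments.const _).add
    ((hx e).pow 2))).smul (hD e)).integrable]
  congr with x
  simp only [smul_smul, ← Finset.sum_smul, steinForm, Finset.mul_sum]
  congr 1
  refine Finset.sum_congr rfl fun e _ => Finset.sum_congr rfl fun f _ => ?_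
  ring

lemma integral_sum_pow_three_sq (h0 : ∀ i, ∫ x, x i ∂ν = 0) :
    ∫ x, (∑ f, x f ^ 3) ^ 2 ∂ν = ∫ x, steinForm ν x ∂ν := by
  have h := integral_sum_pow_three_smul h0 (ψ := id) (ψ' := fun _ => (1 : ℝ)) hasDerivAt_id
    hasFiniteMoments_sum_pow_three (HasFiniteMoments.const 1)
  simpa [pow_two] using h

/-- Each quartic has mean at most `6s² + 9s²`; summing its coefficients over `f` costs `K`, and over
`e` the number of coordinates. -/
lemma integral_steinForm_le (h0 : ∀ i, ∫ x, x i ∂ν = 0) {s K : ℝ}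
    (hs : ∀ i, secondMoment ν i i ≤ s) (hK : ∀ i, ∑ j, |secondMoment ν i j| ≤ K) :
    ∫ x, steinForm ν x ∂ν ≤ Fintype.card ι * K * (15 * s ^ 2) := by
  have hx := hasFiniteMoments_eval (ν := ν)
  have hi : ∀ e f, HasFiniteMoments (fun x : ι → ℝ =>
      (6 * secondMoment ν e e + 3 * x e ^ 2) * x f ^ 2) ν := fun e f =>
    (((HasFiniteMoments.const _).add ((HasFiniteMoments.const _).mul ((hx e).pow 2))).mul
      ((hx f).pow 2))
  have hb : ∀ e f, |∫ x, (6 * secondMoment ν e e + 3 * x e ^ 2) * x f ^ 2 ∂ν| ≤ 15 * s ^ 2 := by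
    intro e f
    have he := secondMoment_self_nonneg ν e
    have h44 : HasFiniteMoments (fun x : ι → ℝ => x e ^ 4 + x f ^ 4) ν :=
      ((hx e).pow 4).add ((hx f).pow 4)
    rw [abs_of_nonneg (integral_nonneg fun x => by positivity)]
    calc ∫ x, (6 * secondMoment ν e e + 3 * x e ^ 2) * x f ^ 2 ∂ν
        ≤ ∫ x, (6 * secondMoment ν e e * x f ^ 2 + 3 / 2 * (x e ^ 4 + x f ^ 4)) ∂ν := by
          refine integral_mono (hi e f).integrable ((((hx f).pow 2).integrable.const_mul _).add
            (h44.integrable.const_mul _)) fun x => ?_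
          dsimp only
          nlinarith [sq_nonneg (x e ^ 2 - x f ^ 2)]
      _ = 6 * secondMoment ν e e * secondMoment ν f f
          + 3 / 2 * (∫ x, x e ^ 4 ∂ν + ∫ x, x f ^ 4 ∂ν) := by
          rw [integral_add (((hx f).pow 2).integrable.const_mul _)
            (h44.integrable.const_mul _),
            integral_const_mul, integral_const_mul, integral_eval_sq,
            integral_add ((hx e).pow 4).integrable ((hx f).pow 4).integrable]
      _ ≤ 15 * s ^ 2 := by
          have h1 := integral_eval_pow_four_le h0 hs e
          have h2 := integral_eval_pow_four_le h0 hs f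
          nlinarith [mul_le_mul (hs e) (hs f) (secondMoment_self_nonneg ν f) (he.trans (hs e))]
  have hs2 : 0 ≤ 15 * s ^ 2 := by positivity
  unfold steinForm
  rw [integral_finsetSum _ fun e _ => (HasFiniteMoments.sum _ fun f =>
    (HasFiniteMoments.const _).mul (hi e f)).integrable]
  calc _ ≤ ∑ e : ι, K * (15 * s ^ 2) := by
        refine Finset.sum_le_sum fun e _ => ?_
        rw [integral_finsetSum _ fun f _ => ((HasFiniteMoments.const _).mul (hi e f)).integrable]
        refine le_trans ?_ (mul_le_mul_of_nonneg_right (hK e) hs2)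
        rw [Finset.sum_mul]
        refine Finset.sum_le_sum fun f _ => ?_
        rw [integral_const_mul]
        refine (le_abs_self _).trans ?_
        rw [abs_mul]
        exact mul_le_mul_of_nonneg_left (hb e f) (abs_nonneg _)
    _ = _ := by simp [mul_assoc]

/-- The coefficients form a chain `g, e, f` of second moments, so each of the two sums costs one row
sum `K`, with no factor for the number of coordinates. -/
lemma abs_integral_mul_steinFormDeriv_le {K B : ℝ} (hB : 0 ≤ B)
    (hK : ∀ i, ∑ j, |secondMoment ν i j| ≤ K) {h : (ι → ℝ) → ℝ} (hh : HasFiniteMoments h ν)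
    (hb : ∀ e f, ∫ x, |h x * (x e * (x f ^ 2 + secondMoment ν f f))| ∂ν ≤ B) (g : ι) :
    |∫ x, h x * steinFormDeriv ν g x ∂ν| ≤ 12 * B * K ^ 2 := by
  have hx := hasFiniteMoments_eval (ν := ν)
  have hm : ∀ e f, HasFiniteMoments
      (fun x : ι → ℝ => h x * (x e * (x f ^ 2 + secondMoment ν f f))) ν := fun e f =>
    hh.mul ((hx e).mul (((hx f).pow 2).add (.const _)))
  have hK0 : 0 ≤ K := (Finset.sum_nonneg fun _ _ => abs_nonneg _).trans (hK g)
  have heq : ∫ x, h x * steinFormDeriv ν g x ∂ν = ∑ e, ∑ f, secondMoment ν g e *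
      secondMoment ν e f * 12 * ∫ x, h x * (x e * (x f ^ 2 + secondMoment ν f f)) ∂ν := by
    simp only [← integral_const_mul]
    have hm' := fun e f => (HasFiniteMoments.const
      (secondMoment ν g e * secondMoment ν e f * 12)).mul (hm e f)
    simp only [← integral_finsetSum _ fun f _ => (hm' _ f).integrable]
    rw [← integral_finsetSum _ fun e _ => (HasFiniteMoments.sum _ (hm' e)).integrable]
    congr with x
    simp only [steinFormDeriv, Finset.mul_sum]
    refine Finset.sum_congr rfl fun e _ => Finset.sum_congr rfl fun f _ => ?_
    ring
  rw [heq]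
  calc _ ≤ ∑ e, ∑ f, |secondMoment ν g e| * |secondMoment ν e f| * 12 * B := by
        refine (Finset.abs_sum_le_sum_abs _ _).trans (Finset.sum_le_sum fun e _ =>
          (Finset.abs_sum_le_sum_abs _ _).trans (Finset.sum_le_sum fun f _ => ?_))
        simp only [abs_mul, Nat.abs_ofNat]
        exact mul_le_mul_of_nonneg_left ((abs_integral_le_integral_abs).trans (by simpa only [abs_mul] using hb e f))
          (by positivity)
    _ = ∑ e, |secondMoment ν g e| * (∑ f, |secondMoment ν e f|) * (12 * B) := by
        simp only [Finset.mul_sum, Finset.sum_mul, mul_assoc]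
    _ ≤ ∑ e, |secondMoment ν g e| * K * (12 * B) := by
        gcongr with e _
        exact hK e
    _ = (∑ e, |secondMoment ν g e|) * (K * (12 * B)) := by
        simp only [Finset.sum_mul, mul_assoc]
    _ ≤ K * (K * (12 * B)) := by gcongr; exact hK g
    _ = _ := by ring

/-- Integrate by parts until `H` is differentiated; the terms in which it never is are multiples of
`∫ H = 0`. The coefficient `9` is `6` from the quadratic part plus `3` from the quartic part. -/
lemma integral_quartic_mul (h0 : ∀ i, ∫ x, x i ∂ν = 0) (e f : ι) {H : (ι → ℝ) → ℝ}
    {D : ι → (ι → ℝ) → ℝ} (hH : ∀ g x, HasLineDerivAt ℝ H (D g x) x (secondMoment ν g))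
    (hHm : HasFiniteMoments H ν) (hDm : ∀ g, HasFiniteMoments (D g) ν) (hH0 : ∫ x, H x ∂ν = 0) :
    ∫ x, ((6 * secondMoment ν e e + 3 * x e ^ 2) * x f ^ 2) * H x ∂ν =
      9 * secondMoment ν e e * ∫ x, x f * D f x ∂ν + 6 * secondMoment ν e f *
        ∫ x, x e * D f x ∂ν + 3 * ∫ x, (x e * x f ^ 2) * D e x ∂ν := by
  have hx := hasFiniteMoments_eval (ν := ν)
  set c := secondMoment ν
  have hd := fun i x v => hasLineDerivAt_eval (ι := ι) i x v
  have k1 : ∀ i, ∫ x, x f * (x i * H x) ∂ν = ∫ x, x i * D f x ∂ν := by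
    intro i
    have := integral_eval_smul h0 f (fun x => (hd i x _).fun_mul (hH f x)) ((hx i).mul hHm)
      (((hx i).mul (hDm f)).add ((HasFiniteMoments.const _).mul hHm))
    simp only [smul_eq_mul] at this
    rw [this, integral_add ((hx i).mul (hDm f)).integrable (hHm.integrable.const_mul _),
      integral_const_mul, hH0, mul_zero, add_zero]
  have m1 : HasFiniteMoments (fun x : ι → ℝ => (x e * x f ^ 2) * D e x) ν :=
    (((hx e).mul ((hx f).pow 2)).mul (hDm e))
  have m2 : HasFiniteMoments (fun x : ι → ℝ => x f * (x e * H x)) ν :=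
    (hx f).mul ((hx e).mul hHm)
  have m3 : HasFiniteMoments (fun x : ι → ℝ => x f * (x f * H x)) ν :=
    (hx f).mul ((hx f).mul hHm)
  have m4 : HasFiniteMoments (fun x : ι → ℝ => x e * ((x e * x f ^ 2) * H x)) ν :=
    (hx e).mul (((hx e).mul ((hx f).pow 2)).mul hHm)
  have k2 : ∫ x, x e * ((x e * x f ^ 2) * H x) ∂ν =
      ∫ x, (x e * x f ^ 2) * D e x ∂ν + (2 * c e f * ∫ x, x f * (x e * H x) ∂ν
        + c e e * ∫ x, x f * (x f * H x) ∂ν) := by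
    have := integral_eval_smul h0 e
      (fun x => ((hd e x _).fun_mul ((hd f x _).fun_pow 2)).fun_mul (hH e x))
      (((hx e).mul ((hx f).pow 2)).mul hHm)
      (m1.add ((((hx e).mul (((HasFiniteMoments.const _).mul ((hx f).pow _)).mul (.const _))).add
        ((HasFiniteMoments.const _).mul ((hx f).pow 2))).mul hHm))
    simp only [smul_eq_mul] at this
    have m5 : HasFiniteMoments (fun x : ι → ℝ =>
        2 * c e f * (x f * (x e * H x)) + c e e * (x f * (x f * H x))) ν :=
      ((HasFiniteMoments.const _).mul m2).add ((HasFiniteMoments.const _).mul m3)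
    rw [this, ← integral_const_mul, ← integral_const_mul, ← integral_add
      (m2.integrable.const_mul _) (m3.integrable.const_mul _), ← integral_add m1.integrable
      m5.integrable]
    congr with x
    simp only [c]
    push_cast
    ring
  calc _ = ∫ x, (6 * c e e * (x f * (x f * H x)) + 3 * (x e * ((x e * x f ^ 2) * H x))) ∂ν := by
        congr with x; ring
    _ = 6 * c e e * ∫ x, x f * (x f * H x) ∂ν + 3 * ∫ x, x e * ((x e * x f ^ 2) * H x) ∂ν := by
        rw [integral_add (m3.integrable.const_mul _) (m4.integrable.const_mul _),
          integral_const_mul, integral_const_mul]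
    _ = _ := by
        rw [k2, k1, k1]
        ring

/-- Bound on the variance of the quartic form. -/
lemma integral_steinForm_sub_sq_le (h0 : ∀ i, ∫ x, x i ∂ν = 0) {s K : ℝ} (hs0 : 0 ≤ s)
    (hs : ∀ i, secondMoment ν i i ≤ s) (hK : ∀ i, ∑ j, |secondMoment ν i j| ≤ K) :
    ∫ x, (steinForm ν x - ∫ y, steinForm ν y ∂ν) ^ 2 ∂ν ≤
      Fintype.card ι * K ^ 3 * (1368 * s ^ 3) := by
  have hx := hasFiniteMoments_eval (ν := ν)
  set V := ∫ y, steinForm ν y ∂ν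
  set c := secondMoment ν
  have hWm := hasFiniteMoments_steinForm (ν := ν)
  set H : (ι → ℝ) → ℝ := fun x => steinForm ν x - V
  have hHm : HasFiniteMoments H ν := hWm.sub (.const V)
  have hH0 : ∫ x, H x ∂ν = 0 := by
    simp only [H]
    rw [integral_sub hWm.integrable (integrable_const _)]
    simp [V]
  have hHd : ∀ g x, HasLineDerivAt ℝ H (steinFormDeriv ν g x) x (secondMoment ν g) := fun g x =>
    HasDerivAt.sub_const V (hasLineDerivAt_steinForm ν g x)
  have hDm := hasFiniteMoments_steinFormDeriv (ν := ν)
  have hq : ∀ e f, HasFiniteMoments (fun x : ι → ℝ =>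
      ((6 * c e e + 3 * x e ^ 2) * x f ^ 2) * H x) ν := fun e f =>
    ((((HasFiniteMoments.const _).add ((HasFiniteMoments.const _).mul ((hx e).pow 2))).mul
      ((hx f).pow 2))).mul hHm
  have hb : ∀ e f, |∫ x, ((6 * c e e + 3 * x e ^ 2) * x f ^ 2) * H x ∂ν| ≤
      1368 * s ^ 3 * K ^ 2 := by
    intro e f
    rw [integral_quartic_mul h0 e f hHd hHm hDm hH0]
    have b4 : ∀ i g, |∫ x, x i * steinFormDeriv ν g x ∂ν| ≤ 12 * (4 * s ^ 2) * K ^ 2 := fun i g =>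
      abs_integral_mul_steinFormDeriv_le (by positivity) hK (hx i)
        (integral_abs_mul_quadratic_le h0 hs i) g
    have b6 : ∀ i j g, |∫ x, (x i * x j ^ 2) * steinFormDeriv ν g x ∂ν| ≤
        12 * (18 * s ^ 3) * K ^ 2 := fun i j g =>
      abs_integral_mul_steinFormDeriv_le (by positivity) hK ((hx i).mul ((hx j).pow 2))
        (integral_abs_mul_sq_mul_quadratic_le h0 hs i j) g
    have hcs := abs_secondMoment_le (ν := ν) hs
    calc _ ≤ |9 * c e e * ∫ x, x f * steinFormDeriv ν f x ∂ν|
          + |6 * c e f * ∫ x, x e * steinFormDeriv ν f x ∂ν|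
          + |3 * ∫ x, (x e * x f ^ 2) * steinFormDeriv ν e x ∂ν| := abs_add_three _ _ _
      _ ≤ 9 * s * (12 * (4 * s ^ 2) * K ^ 2) + 6 * s * (12 * (4 * s ^ 2) * K ^ 2)
          + 3 * (12 * (18 * s ^ 3) * K ^ 2) := by
        simp only [abs_mul, Nat.abs_ofNat]
        gcongr
        · exact hcs e e
        · exact b4 f f
        · exact hcs e f
        · exact b4 e f
        · simpa only [abs_mul] using b6 e f e
      _ = _ := by ring
  -- As `H` is centred, one factor `H` may be replaced by `steinForm ν`, which is then expanded into
  -- quartics.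
  calc ∫ x, H x ^ 2 ∂ν = ∫ x, steinForm ν x * H x ∂ν := by
        have : ∀ x, H x ^ 2 = steinForm ν x * H x - V * H x := fun x => by simp only [H]; ring
        simp only [this]
        rw [integral_sub (hWm.mul hHm).integrable (hHm.integrable.const_mul _),
          integral_const_mul, hH0, mul_zero, sub_zero]
    _ = ∑ e, ∑ f, c e f * ∫ x, ((6 * c e e + 3 * x e ^ 2) * x f ^ 2) * H x ∂ν := by
        simp only [← integral_const_mul]
        have hm' := fun e f => (HasFiniteMoments.const (c e f)).mul (hq e f)
        simp only [← integral_finsetSum _ fun f _ => (hm' _ f).integrable]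
        rw [← integral_finsetSum _ fun e _ => (HasFiniteMoments.sum _ (hm' e)).integrable]
        congr with x
        simp only [steinForm, Finset.sum_mul, c, mul_assoc]
    _ ≤ ∑ e, ∑ f, |c e f| * (1368 * s ^ 3 * K ^ 2) := by
        refine Finset.sum_le_sum fun e _ => Finset.sum_le_sum fun f _ => ?_
        refine (le_abs_self _).trans ?_
        rw [abs_mul]
        exact mul_le_mul_of_nonneg_left (hb e f) (abs_nonneg _)
    _ ≤ ∑ e : ι, K * (1368 * s ^ 3 * K ^ 2) := by
        refine Finset.sum_le_sum fun e _ => ?_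
        rw [← Finset.sum_mul]
        exact mul_le_mul_of_nonneg_right (hK e) (by positivity)
    _ = _ := by
        simp only [Finset.sum_const, Finset.card_univ, nsmul_eq_mul]
        ring

end CubicForm

/-! ### Comparison of characteristic functions. -/

section CharacteristicFunction

variable {ι : Type*} [Fintype ι] {ν : Measure (ι → ℝ)} [IsGaussian ν]

lemma hasDerivAt_integral_exp_mul_I {U : (ι → ℝ) → ℝ} (hU : HasFiniteMoments U ν) (t : ℝ) :
    HasDerivAt (fun t : ℝ => ∫ x, Complex.exp (t * U x * Complex.I) ∂ν)
      (∫ x, U x • (Complex.I * Complex.exp (t * U x * Complex.I)) ∂ν) t := by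
  have hUc := hU.continuous
  have hc : ∀ t : ℝ, Continuous fun x => Complex.exp (t * U x * Complex.I) := fun t => by fun_prop
  refine (hasDerivAt_integral_of_dominated_loc_of_deriv_le (s := Set.univ)
    (bound := fun x => |U x|) (F := fun (t : ℝ) x => Complex.exp (t * U x * Complex.I))
    (F' := fun (t : ℝ) x => U x • (Complex.I * Complex.exp (t * U x * Complex.I)))
    univ_mem (Eventually.of_forall fun t => (hc t).aestronglyMeasurable) ?_ ?_ ?_
    hU.abs.integrable ?_).2
  · exact (HasFiniteMoments.of_bound (hc t) 1 fun x => by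
      rw [← Complex.ofReal_mul, Complex.norm_exp_ofReal_mul_I]).integrable
  · exact (by fun_prop : Continuous _).aestronglyMeasurable
  · refine ae_of_all _ fun x t _ => ?_
    rw [norm_smul, norm_mul, ← Complex.ofReal_mul, Complex.norm_exp_ofReal_mul_I]
    simp
  · refine ae_of_all _ fun x t _ => ?_
    have h1 : HasDerivAt (fun t : ℝ => (t : ℂ) * U x * Complex.I) (U x * Complex.I) t := by
      simpa using ((Complex.ofRealCLM.hasDerivAt (x := t)).mul_const (U x : ℂ)).mul_const Complex.I
    refine h1.cexp.congr_deriv ?_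
    rw [Complex.real_smul]
    ring

/-- The characteristic function of `U = ∑ x i ^ 3` is close to that of a Gaussian variable of the
same variance as soon as `steinForm ν` is close to its mean. -/
theorem norm_integral_exp_sum_pow_three_sub_le (h0 : ∀ i, ∫ x, x i ∂ν = 0) :
    ‖∫ x, Complex.exp ((∑ i, x i ^ 3 : ℝ) * Complex.I) ∂ν -
      (Real.exp (-(1 / 2) * ∫ x, steinForm ν x ∂ν) : ℝ)‖ ≤
    ∫ x, |steinForm ν x - ∫ y, steinForm ν y ∂ν| ∂ν := by
  have hWm := hasFiniteMoments_steinForm (ν := ν)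
  set W := steinForm ν
  set V := ∫ x, W x ∂ν
  set δ := ∫ x, |W x - V| ∂ν
  have hUm := hasFiniteMoments_sum_pow_three (ν := ν)
  set U : (ι → ℝ) → ℝ := fun x => ∑ i, x i ^ 3 with hU
  have hUc := hUm.continuous
  have hV : 0 ≤ V := by
    change 0 ≤ ∫ x, steinForm ν x ∂ν
    rw [← integral_sum_pow_three_sq h0]
    exact integral_nonneg fun x => sq_nonneg _
  have hexp : ∀ t : ℝ, HasFiniteMoments (fun x => Complex.exp (t * U x * Complex.I)) ν :=
    fun t => .of_bound (by fun_prop) 1 fun x => by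
      rw [← Complex.ofReal_mul, Complex.norm_exp_ofReal_mul_I]
  have hIexp : ∀ t : ℝ,
      HasFiniteMoments (fun x => Complex.I * Complex.exp (t * U x * Complex.I)) ν :=
    fun t => .of_bound (by fun_prop) 1 fun x => by
      rw [norm_mul, ← Complex.ofReal_mul, Complex.norm_exp_ofReal_mul_I]
      simp
  have hIexp' : ∀ t : ℝ,
      HasFiniteMoments (fun x => -(t : ℂ) * Complex.exp (t * U x * Complex.I)) ν :=
    fun t => .of_bound (by fun_prop) |t| fun x => by
      rw [norm_mul, ← Complex.ofReal_mul, Complex.norm_exp_ofReal_mul_I]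
      simp
  have hstein : ∀ t : ℝ, ∫ x, U x • (Complex.I * Complex.exp (t * U x * Complex.I)) ∂ν =
      -(t : ℂ) * ∫ x, W x • Complex.exp (t * U x * Complex.I) ∂ν := fun t => by
    have h := integral_sum_pow_three_smul h0
      (ψ := fun y : ℝ => Complex.I * Complex.exp (t * y * Complex.I))
      (ψ' := fun y : ℝ => -(t : ℂ) * Complex.exp (t * y * Complex.I)) (fun y => by
        have h1 : HasDerivAt (fun y : ℝ => (t : ℂ) * y * Complex.I) (t * Complex.I) y := by
          simpa using ((Complex.ofRealCLM.hasDerivAt (x := y)).const_mul (t : ℂ)).mul_const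
            Complex.I
        refine (h1.cexp.const_mul Complex.I).congr_deriv ?_
        linear_combination (t : ℂ) * Complex.exp (t * y * Complex.I) * Complex.I_mul_I)
      (hIexp t) (hIexp' t)
    rw [h, ← integral_const_mul]
    congr with x
    simp only [Complex.real_smul, W, hU]
    ring
  set φ : ℝ → ℂ := fun t => ∫ x, Complex.exp (t * U x * Complex.I) ∂ν with hφ
  -- The integrating factor of `φ' = -t V φ` leaves only the contribution of `W - V`.
  have hder : ∀ t : ℝ, HasDerivAt (fun t : ℝ => Real.exp (V / 2 * t ^ 2) • φ t)
      (-(t * Real.exp (V / 2 * t ^ 2)) •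
        ∫ x, (W x - V) • Complex.exp (t * U x * Complex.I) ∂ν) t := by
    intro t
    have h1 := hasDerivAt_integral_exp_mul_I hUm t
    rw [hstein] at h1
    have h2 : HasDerivAt (fun t : ℝ => Real.exp (V / 2 * t ^ 2))
        (Real.exp (V / 2 * t ^ 2) * (V * t)) t := by
      have := (((hasDerivAt_id t).pow 2).const_mul (V / 2)).exp
      refine this.congr_deriv ?_
      simp only [id, Pi.pow_apply]
      ring
    refine (h2.smul h1).congr_deriv ?_
    simp only [sub_smul]
    rw [integral_sub (hWm.smul (hexp t)).integrable 
      (((HasFiniteMoments.const V).smul (hexp t)).integrable), integral_smul]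
    simp only [Complex.real_smul]
    push_cast
    ring
  have hmain := norm_image_sub_le_of_norm_deriv_le_segment_01' (C := Real.exp (V / 2) * δ)
    (fun t _ => (hder t).hasDerivWithinAt) (fun t ht => by
      rw [norm_smul]
      refine mul_le_mul ?_ ?_ (norm_nonneg _) (Real.exp_pos _).le
      · rw [Real.norm_eq_abs, abs_neg, abs_of_nonneg (mul_nonneg ht.1 (Real.exp_pos _).le)]
        have ht2 : t ^ 2 ≤ 1 := by nlinarith [ht.1, ht.2]
        calc t * Real.exp (V / 2 * t ^ 2) ≤ 1 * Real.exp (V / 2) := by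
              refine mul_le_mul ht.2.le (Real.exp_le_exp.2 (by nlinarith)) (Real.exp_pos _).le
                zero_le_one
          _ = _ := one_mul _
      · refine (norm_integral_le_integral_norm _).trans_eq ?_
        congr with x
        rw [norm_smul, ← Complex.ofReal_mul, Complex.norm_exp_ofReal_mul_I, mul_one,
          Real.norm_eq_abs])
  have hφ0 : φ 0 = 1 := by simp [hφ]
  have hφ1 : φ 1 = ∫ x, Complex.exp ((U x : ℝ) * Complex.I) ∂ν := by simp [hφ]
  simp only [one_pow, mul_one, ne_eq, OfNat.ofNat_ne_zero, not_false_eq_true, zero_pow, mul_zero,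
    Real.exp_zero, hφ0, one_smul] at hmain
  change ‖∫ x, Complex.exp ((U x : ℝ) * Complex.I) ∂ν - _‖ ≤ δ
  rw [← hφ1]
  have hfac : φ 1 - (Real.exp (-(1 / 2) * V) : ℝ) =
      Real.exp (-(1 / 2) * V) • (Real.exp (V / 2) • φ 1 - 1) := by
    rw [smul_sub, smul_smul, ← Real.exp_add, show -(1 / 2) * V + V / 2 = 0 by ring, Real.exp_zero,
      one_smul, Complex.real_smul, mul_one]
  rw [hfac, norm_smul, Real.norm_eq_abs, Real.abs_exp]
  calc _ ≤ Real.exp (-(1 / 2) * V) * (Real.exp (V / 2) * δ) := by gcongr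
    _ = δ := by
      rw [← mul_assoc, ← Real.exp_add, show -(1 / 2) * V + V / 2 = 0 by ring, Real.exp_zero,
        one_mul]

end CharacteristicFunction

/-! ### Counting pairs and bounding row sums. -/

section Pairs

variable {n : ℕ}

lemma card_unorderedPair_le : Fintype.card (UnorderedPair n) ≤ n ^ 2 := by
  rw [Fintype.card_finset_len, Fintype.card_fin]
  exact Nat.choose_le_pow n 2

lemma card_filter_mem_le (v : Fin n) :
    (Finset.univ.filter fun f : UnorderedPair n => v ∈ f.1).card ≤ n := by
  classical
  have : (Finset.univ.filter fun f : UnorderedPair n => v ∈ f.1).card ≤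
      (Finset.univ.image fun w : Fin n => ({v, w} : Finset (Fin n))).card := by
    refine Finset.card_le_card_of_injOn (fun f => f.1) ?_ Subtype.val_injective.injOn
    intro f hf
    simp only [Finset.coe_filter, Finset.mem_univ, true_and, Set.mem_ofPred_eq] at hf
    obtain ⟨a, b, hab, h⟩ := Finset.card_eq_two.1 f.2
    simp only [Finset.coe_image, Finset.coe_univ, Set.image_univ, Set.mem_range]
    rw [h] at hf ⊢
    simp only [Finset.mem_insert, Finset.mem_singleton] at hf
    rcases hf with rfl | rfl
    · exact ⟨b, rfl⟩
    · exact ⟨a, Finset.pair_comm _ _⟩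
  exact (this.trans Finset.card_image_le).trans_eq (by simp)

lemma card_filter_not_disjoint_le (e : UnorderedPair n) :
    (Finset.univ.filter fun f : UnorderedPair n => ¬ Disjoint e.1 f.1).card ≤ 2 * n := by
  classical
  calc _ ≤ (e.1.biUnion fun v => Finset.univ.filter fun f : UnorderedPair n => v ∈ f.1).card := by
        refine Finset.card_le_card fun f hf => ?_
        simp only [Finset.mem_filter, Finset.mem_univ, true_and, Finset.not_disjoint_iff] at hf
        simpa using hf
    _ ≤ e.1.card * n := Finset.card_biUnion_le_card_mul _ _ _ fun v _ => card_filter_mem_le v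
    _ = 2 * n := by rw [e.2]

/-- At most `2n` pairs meet `e`, contributing `θ/n` each, and at most `n²` are disjoint from it,
contributing `θ/n²` each. -/
lemma sum_abs_le_of_disjoint {θ : ℝ} (hθ : 0 ≤ θ) {c : UnorderedPair n → UnorderedPair n → ℝ}
    (h1 : ∀ e f, |c e f| ≤ θ / n) (h2 : ∀ e f : UnorderedPair n, Disjoint e.1 f.1 →
      |c e f| ≤ θ / (n : ℝ) ^ 2) (e : UnorderedPair n) : ∑ f, |c e f| ≤ 3 * θ := by
  classical
  rw [← Finset.sum_filter_not_add_sum_filter _ (fun f : UnorderedPair n => Disjoint e.1 f.1)]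
  rcases Nat.eq_zero_or_pos n with rfl | hn
  · have := e.2
    simp [Finset.eq_empty_of_isEmpty e.1] at this
  have hn' : (0 : ℝ) < n := by exact_mod_cast hn
  have hA : ∑ f : UnorderedPair n with ¬ Disjoint e.1 f.1, |c e f| ≤ 2 * θ := by
    calc _ ≤ _ := Finset.sum_le_card_nsmul _ _ (θ / n) fun f _ => h1 e f
      _ ≤ ((2 * n : ℕ) : ℝ) * (θ / n) := by
        rw [nsmul_eq_mul]
        gcongr
        exact card_filter_not_disjoint_le e
      _ = 2 * θ := by push_cast; field_simp
  have hB : ∑ f : UnorderedPair n with Disjoint e.1 f.1, |c e f| ≤ θ := by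
    calc _ ≤ _ := Finset.sum_le_card_nsmul _ _ (θ / (n : ℝ) ^ 2) fun f hf =>
          h2 e f (Finset.mem_filter.1 hf).2
      _ ≤ ((n ^ 2 : ℕ) : ℝ) * (θ / (n : ℝ) ^ 2) := by
        rw [nsmul_eq_mul]
        gcongr
        exact (Finset.card_filter_le _ _).trans card_unorderedPair_le
      _ = θ := by push_cast; field_simp
  linarith

end Pairs

/-! ### Bounds in terms of `θ` and `n`, and the main theorem. -/

section Bounds

variable {n : ℕ} {ν : Measure (UnorderedPair n → ℝ)} [IsGaussian ν] {θ : ℝ}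

lemma integral_cubicSum_sq_le (hθ : 0 < θ) (h0 : ∀ e, ∫ x, x e ∂ν = 0)
    (hs : ∀ e, secondMoment ν e e ≤ θ / n) (hK : ∀ e, ∑ f, |secondMoment ν e f| ≤ 3 * θ) :
    ∫ x, (∑ e, x e ^ 3) ^ 2 ∂ν ≤ 45 * θ ^ 3 := by
  rw [integral_sum_pow_three_sq h0]
  refine (integral_steinForm_le h0 hs hK).trans ?_
  calc _ ≤ ((n ^ 2 : ℕ) : ℝ) * (3 * θ) * (15 * (θ / n) ^ 2) := by
        gcongr
        exact card_unorderedPair_le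
    _ = 45 * θ ^ 3 * (n / n) ^ 2 := by push_cast; ring
    -- An inequality because `n / n = 0` when `n = 0`.
    _ ≤ 45 * θ ^ 3 * 1 ^ 2 := by gcongr; exact div_self_le_one _
    _ = _ := by ring

lemma integral_steinForm_sub_sq_le_div (hθ : 0 < θ) (h0 : ∀ e, ∫ x, x e ∂ν = 0)
    (hs : ∀ e, secondMoment ν e e ≤ θ / n) (hK : ∀ e, ∑ f, |secondMoment ν e f| ≤ 3 * θ) :
    ∫ x, (steinForm ν x - ∫ y, steinForm ν y ∂ν) ^ 2 ∂ν ≤ 36936 * θ ^ 6 / n := by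
  refine (integral_steinForm_sub_sq_le h0 (by positivity) hs hK).trans ?_
  calc _ ≤ ((n ^ 2 : ℕ) : ℝ) * (3 * θ) ^ 3 * (1368 * (θ / n) ^ 3) := by
        gcongr
        exact card_unorderedPair_le
    _ = 36936 * θ ^ 6 / n * (n / n) ^ 2 := by push_cast; ring
    _ ≤ 36936 * θ ^ 6 / n * 1 ^ 2 := by gcongr; exact div_self_le_one _
    _ = _ := by ring

/-- The exponent `3 + D + b` is large enough to absorb the constant `D`. -/
lemma div_le_sq_of_rpow_le {D b ε N : ℝ} (hD : 0 ≤ D) (hb : 0 ≤ b) (hε : 0 < ε) (hε2 : ε < 1 / 2)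
    (hN : (1 / ε) ^ (3 + D + b) ≤ N) : D / N ≤ ε ^ 2 := by
  have h2 : 2 ≤ 1 / ε := by rw [le_div_iff₀ hε]; linarith
  have hNpos : 0 < N := (Real.rpow_pos_of_pos (by positivity) _).trans_le hN
  -- Bernoulli's inequality with base `2 ≤ 1 / ε`; the remaining exponent `2` yields `ε ^ 2`.
  have h1 : D ≤ (1 / ε) ^ (1 + D + b) := by
    have := one_add_mul_self_le_rpow_one_add (s := 1) (by norm_num)
      (p := 1 + D + b) (by linarith)
    calc D ≤ 1 + (1 + D + b) * 1 := by linarith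
      _ ≤ (1 + 1) ^ (1 + D + b) := this
      _ ≤ _ := Real.rpow_le_rpow (by norm_num) (by linarith) (by linarith)
  rw [div_le_iff₀ hNpos]
  calc D = ε ^ 2 * ((1 / ε) ^ 2 * D) := by field_simp
    _ ≤ ε ^ 2 * ((1 / ε) ^ (2 : ℝ) * (1 / ε) ^ (1 + D + b)) := by
        rw [Real.rpow_two]
        gcongr
    _ = ε ^ 2 * (1 / ε) ^ (3 + D + b) := by
        rw [← Real.rpow_add (by positivity)]
        ring_nf
    _ ≤ _ := by gcongr

end Bounds

/-- Joint Gaussianity is `HasGaussianLaw` of the random vector `ω ↦ (u e ω)_e`; the law may be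
degenerate. The constant `γ` depends on `θ` only. -/
theorem theorem5p1 (θ : ℝ) (hθ : 0 < θ) :
    ∃ γ : ℝ, 0 < γ ∧
      ∀ (n : ℕ) (Ω : Type*) [MeasurableSpace Ω] (μ : MeasureTheory.Measure Ω)
        [MeasureTheory.IsProbabilityMeasure μ] (u : UnorderedPair n → Ω → ℝ),
        ProbabilityTheory.HasGaussianLaw (fun ω => fun e : UnorderedPair n => u e ω) μ →
        (∀ e, ∫ ω, u e ω ∂μ = 0) →
        (∀ e, ∫ ω, u e ω ^ 2 ∂μ ≤ θ / (n : ℝ)) →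
        (∀ e f : UnorderedPair n, Disjoint e.1 f.1 →
          |∫ ω, u e ω * u f ω ∂μ| ≤ θ / (n : ℝ) ^ 2) →
        (MeasureTheory.Integrable (fun ω => cubicSum u ω ^ 2) μ ∧
          ∫ ω, cubicSum u ω ^ 2 ∂μ ≤ γ) ∧
        ∀ ε : ℝ, 0 < ε → ε < 1 / 2 → (1 / ε) ^ γ ≤ (n : ℝ) →
          ‖(∫ ω, Complex.exp (Complex.I * (cubicSum u ω : ℂ)) ∂μ) -
            ((Real.exp (-(1 / 2) * ∫ ω, cubicSum u ω ^ 2 ∂μ) : ℝ) : ℂ)‖ ≤ ε := by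
  -- `45 * θ ^ 3` bounds the second moment; `36936 * θ ^ 6`, where `36936 = 27 * 1368`, is the
  -- numerator of the variance bound.
  refine ⟨3 + 36936 * θ ^ 6 + 45 * θ ^ 3, by positivity, ?_⟩
  intro n Ω _ μ _ u hu hmean hvar hcov
  set X : Ω → UnorderedPair n → ℝ := fun ω e => u e ω with hX
  set ν : Measure (UnorderedPair n → ℝ) := μ.map X with hν
  have : IsGaussian ν := hu.isGaussian_map
  have hXm : AEMeasurable X μ := hu.aemeasurable
  have htr : ∀ F : (UnorderedPair n → ℝ) → ℝ, Continuous F → ∫ x, F x ∂ν = ∫ ω, F (X ω) ∂μ :=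
    fun F hF => integral_map hXm hF.aestronglyMeasurable
  have h0 : ∀ e, ∫ x, x e ∂ν = 0 := fun e => (htr _ (continuous_apply e)).trans (hmean e)
  have hc : ∀ e f, secondMoment ν e f = ∫ ω, u e ω * u f ω ∂μ := fun e f =>
    htr (fun x => x e * x f) (by fun_prop)
  have hs : ∀ e, secondMoment ν e e ≤ θ / n := fun e => by
    rw [hc]
    simpa only [pow_two] using hvar e
  have hK : ∀ e, ∑ f, |secondMoment ν e f| ≤ 3 * θ :=
    sum_abs_le_of_disjoint hθ.le (abs_secondMoment_le hs) fun e f h => by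
      rw [hc]
      exact hcov e f h
  have hU2 : ∫ x, (∑ e, x e ^ 3) ^ 2 ∂ν = ∫ ω, cubicSum u ω ^ 2 ∂μ :=
    htr (fun x => (∑ e, x e ^ 3) ^ 2) (by fun_prop)
  refine ⟨⟨?_, ?_⟩, fun ε hε hε2 hn => ?_⟩
  · have hm := (hasFiniteMoments_sum_pow_three (ν := ν)).pow 2
    exact (integrable_map_measure hm.continuous.aestronglyMeasurable hXm).1 hm.integrable
  · rw [← hU2]
    have := integral_cubicSum_sq_le hθ h0 hs hK
    have : 0 < 36936 * θ ^ 6 := by positivity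
    linarith
  · have hmain := norm_integral_exp_sum_pow_three_sub_le h0
    rw [← integral_sum_pow_three_sq h0, hU2, hν, integral_map hXm
      (by fun_prop : Continuous _).aestronglyMeasurable] at hmain
    simp only [mul_comm Complex.I]
    refine hmain.trans ?_
    have hm := (hasFiniteMoments_steinForm (ν := ν)).sub
      (.const (∫ x, (∑ e, x e ^ 3) ^ 2 ∂ν))
    have hV := (integral_steinForm_sub_sq_le_div hθ h0 hs hK).trans
      (div_le_sq_of_rpow_le (by positivity) (by positivity) hε hε2 hn)
    rw [← integral_sum_pow_three_sq h0] at hV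
    rw [← hU2, ← hν]
    set H := fun x => steinForm ν x - ∫ x, (∑ e, x e ^ 3) ^ 2 ∂ν
    -- Weighted AM-GM in place of Cauchy–Schwarz; the weight is optimal when `∫ H² = ε²`.
    calc ∫ x, |H x| ∂ν ≤ ∫ x, (1 / (2 * ε) * H x ^ 2 + ε / 2) ∂ν := by
          refine integral_mono hm.abs.integrable (((hm.pow 2).integrable.const_mul _).add
            (integrable_const _)) fun x => ?_
          have : 1 / (2 * ε) * H x ^ 2 + ε / 2 - |H x| = 1 / (2 * ε) * (|H x| - ε) ^ 2 := by
            rw [← sq_abs (H x)]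
            field_simp
            ring
          have h2 : 0 ≤ 1 / (2 * ε) * (|H x| - ε) ^ 2 := by positivity
          dsimp only
          linarith
      _ = 1 / (2 * ε) * ∫ x, H x ^ 2 ∂ν + ε / 2 := by
          rw [integral_add ((hm.pow 2).integrable.const_mul _) (integrable_const _),
            integral_const_mul]
          simp
      _ ≤ 1 / (2 * ε) * ε ^ 2 + ε / 2 := by gcongr
      _ = ε := by field_simp; ring
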